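/- Let $X=\{0,1\}^{\mathbb N}$ with the shift $(\sigma x)_n=x_{n+1}$. For a $\sigma$-invariant Borel probability measure $\nu$ on $X$ write $\langle f,\nu\rangle=\int f\,d\nu$ and let $$h(\nu)=\lim_{n\to\infty}-\frac1n\sum_{w\in\{0,1\}^n}\nu[w]\log\nu[w]$$ be its entropy, where $[w]$ is the cylinder set of the word $w$. For $f\in C(X)$ let $P(f)=\sup_\nu\big(h(\nu)+\langle f,\nu\rangle\big)$, the supremum being over all $\sigma$-invariant Borel probability measures; a measure at which it is attained is called an equilibrium state for $f$. Let $(a_k)_{k\ge0}$ be a sequence of negative real numbers with $a_k\to0$, and put $s_k=a_0+\dots+a_k$. Define $\phi:X\to\mathbb R$ by $\phi(x)=a_k$ if $x_0=\dots=x_{k-1}=1$ and $x_k=0$ $(k\ge0)$, and $\phi(11\dots)=0$. Assume $$\sum_{k=0}^\infty e^{s_k}=1\quad\text{and}\quad\sum_{k=0}^\infty(k+1)e^{s_k}<\infty .$$ Then $\phi$ is continuous, $P(\beta\phi)$ is finite for every $\beta\in\mathbb R$, and the following hold. 1. $P(\beta\phi)=0$ for all $\beta\ge1$; in particular the right derivative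 of $\beta\mapsto P(\beta\phi)$ at $\beta=1$ is $0$. 2. The unit mass $\delta_{11\dots}$ is an equilibrium state for $\phi$, and there is an equilibrium state for $\phi$ different from $\delta_{11\dots}$. 3. For every equilibrium state $\mu_1\ne\delta_{11\dots}$ for $\phi$ one has $h(\mu_1)+\langle\phi,\mu_1\rangle=0$, $\langle\phi,\mu_1\rangle<0$, and $P(\beta\phi)\ge-(1-\beta)\langle\phi,\mu_1\rangle$ for all $\beta\in\mathbb R$. The left derivative $D$ of $\beta\mapsto P(\beta\phi)$ at $\beta=1$ exists and satisfies $D\le\langle\phi,\mu_1\rangle<0$ for every such $\mu_1$; that is, $|D|\ge-\langle\phi,\mu_1\rangle>0$. 4. Consequently $\beta\mapsto P(\beta\phi)$ is not differentiable at $\beta=1$. -/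

import Mathlib

open MeasureTheory Filter Topology Set

/-- The one-sided shift `(σ x)_n = x_{n+1}` on `A^ℕ`. -/
def shift {A : Type*} (x : ℕ → A) : ℕ → A := fun n => x (n + 1)

/-- The cylinder set `[w_0 … w_{n-1}]` in `A^ℕ`. -/
def cylinderSet {A : Type*} {n : ℕ} (w : Fin n → A) : Set (ℕ → A) :=
  {x | ∀ i : Fin n, x i = w i}

/-- Shift-invariant Borel probability measures on `A^ℕ`. -/
def IsInvariantProb {A : Type*} [MeasurableSpace A] (ν : Measure (ℕ → A)) : Prop :=
  IsProbabilityMeasure ν ∧ MeasurePreserving shift ν ν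

/-- The block entropy `H_n(ν) = -∑ ν[w] log ν[w]`, the sum being over all words `w` of length `n`
(with `0 log 0 = 0`). -/
noncomputable def blockEntropy {A : Type*} [Fintype A] [MeasurableSpace A]
    (ν : Measure (ℕ → A)) (n : ℕ) : ℝ :=
  ∑ w : Fin n → A, Real.negMulLog (ν.real (cylinderSet w))

/-- The entropy `h(ν) = lim H_n(ν) / n` of an invariant probability measure. -/
noncomputable def shiftEntropy {A : Type*} [Fintype A] [MeasurableSpace A]
    (ν : Measure (ℕ → A)) : ℝ :=
  limUnder atTop (fun n : ℕ => blockEntropy ν n / (n : ℝ))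

/-- The values `h(ν) + ⟨f, ν⟩`, where `ν` runs through the invariant probability measures. -/
def freeEnergies {A : Type*} [Fintype A] [MeasurableSpace A] (f : (ℕ → A) → ℝ) : Set ℝ :=
  {r | ∃ ν : Measure (ℕ → A), IsInvariantProb ν ∧ r = shiftEntropy ν + ∫ x, f x ∂ν}

/-- The pressure `P(f) = sup {h(ν) + ⟨f, ν⟩ : ν invariant}` of a continuous observable `f`. -/
noncomputable def pressure {A : Type*} [Fintype A] [MeasurableSpace A]
    (f : (ℕ → A) → ℝ) : ℝ :=
  sSup (freeEnergies f)

/-- An equilibrium state for `f`: an invariant probability measure at which the supremum defining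
the pressure is attained. -/
def IsEquilibriumState {A : Type*} [Fintype A] [MeasurableSpace A]
    (f : (ℕ → A) → ℝ) (μ : Measure (ℕ → A)) : Prop :=
  IsInvariantProb μ ∧ IsGreatest (freeEnergies f) (shiftEntropy μ + ∫ x, f x ∂μ)

/-- `M_k`, the set of `x ∈ {0,1}^ℕ` with `x_0 = … = x_{k-1} = 1` and `x_k = 0`. -/
def hofbauerSet (k : ℕ) : Set (ℕ → Fin 2) :=
  {x | (∀ i < k, x i = 1) ∧ x k = 0}

open scoped Classical in
/-- The Hofbauer observable: `φ = a_k` on `M_k`, and `φ(11…) = 0`. The index of the first `0` in `x`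
is the unique `k` with `x ∈ M_k`. -/
noncomputable def hofbauerPotential (a : ℕ → ℝ) (x : ℕ → Fin 2) : ℝ :=
  if h : ∃ k, x k = 0 then a (Nat.find h) else 0

theorem hofbauerPotential_of_mem (a : ℕ → ℝ) {k : ℕ} {x : ℕ → Fin 2} (hx : x ∈ hofbauerSet k) :
    hofbauerPotential a x = a k := by
  have h : ∃ k, x k = 0 := ⟨k, hx.2⟩
  have hk : Nat.find h = k := by
    rw [Nat.find_eq_iff]
    refine ⟨hx.2, fun i hi h0 => ?_⟩
    have := hx.1 i hi
    simp [h0] at this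
  unfold hofbauerPotential
  rw [dif_pos h]
  congr 1

theorem hofbauerPotential_ones (a : ℕ → ℝ) : hofbauerPotential a (fun _ => 1) = 0 := by
  simp [hofbauerPotential]

/-! The numbers p_k = e^{s_k} form a probability law. In the renewal process in which the runs of
ones between consecutive zeros are independent with law p, the finite first moment permits a
stationary version μ. A run of k ones with its closing zero has Birkhoff sum a_k + … + a_0 = s_k =
log p_k, so complete runs contribute equally to log μ[x_0…x_{n-1}] and to S_nφ(x). Only the two
boundary runs differ, by O(∑_{i≤n} sup_{j≥i}|a_j|) + O(1), which is o(n) because a_k → 0. This weak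
Gibbs property is `abs_log_renewalWeight_sub_birkhoffSum_le`.

Gibbs' inequality against the cylinder masses of μ then gives h(ν) + ⟨φ,ν⟩ ≤ 0 for every invariant
ν, and the opposite bound for μ itself gives equality (`hofbauer_variational`). The unit mass at 11…
also has value 0. Since φ ≤ 0, the pressure stays 0 for β ≥ 1. Each equilibrium state μ₁ supplies
the line (β-1)⟨φ,μ₁⟩ below the convex function P(βφ), touching it at β = 1. Since φ vanishes only at
11…, this line has negative slope when μ₁ ≠ δ, which forces a corner at β = 1. -/

/-! ### Block entropy, its limit, and entropy bounds from weak Gibbs estimates -/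

section Entropy

/-- Gibbs' inequality. -/
theorem sum_negMulLog_le_of_sum_le {ι : Type*} (s : Finset ι) {p q : ι → ℝ}
    (hp : ∀ i ∈ s, 0 ≤ p i) (hq : ∀ i ∈ s, 0 ≤ q i) (hpq : ∀ i ∈ s, q i = 0 → p i = 0)
    (hsum : ∑ i ∈ s, q i ≤ ∑ i ∈ s, p i) :
    ∑ i ∈ s, Real.negMulLog (p i) ≤ ∑ i ∈ s, p i * (-Real.log (q i)) := by
  have key : ∀ i ∈ s, Real.negMulLog (p i) - p i * (-Real.log (q i)) ≤ q i - p i := by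
    intro i hi
    rcases (hp i hi).eq_or_lt with h0 | h0
    · rw [← h0]; simpa using hq i hi
    · have hqi : 0 < q i :=
        lt_of_le_of_ne (hq i hi) fun h => h0.ne' (hpq i hi h.symm)
      have h1 := Real.log_le_sub_one_of_pos (div_pos hqi h0)
      rw [Real.log_div hqi.ne' h0.ne'] at h1
      have h2 := mul_le_mul_of_nonneg_left h1 h0.le
      have h3 : p i * (q i / p i - 1) = q i - p i := by field_simp
      unfold Real.negMulLog
      linarith
  have := Finset.sum_le_sum key
  rw [Finset.sum_sub_distrib, Finset.sum_sub_distrib] at this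
  linarith

variable {A : Type*}

/-- The word formed by the first `n` letters of `x`. -/
def wordPrefix (n : ℕ) (x : ℕ → A) : Fin n → A := fun i => x i

theorem cylinderSet_eq_preimage {n : ℕ} (w : Fin n → A) :
    cylinderSet w = wordPrefix n ⁻¹' {w} := by
  ext x; simp [cylinderSet, wordPrefix, funext_iff]

theorem shift_iterate (m : ℕ) (x : ℕ → A) : shift^[m] x = fun n => x (n + m) := by
  induction m generalizing x with
  | zero => rfl
  | succ m ih =>
    rw [Function.iterate_succ_apply, ih]
    funext n
    simp only [shift]
    congr 1

theorem wordPrefix_add (m n : ℕ) (x : ℕ → A) :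
    wordPrefix (m + n) x = Fin.append (wordPrefix m x) (wordPrefix n (shift^[m] x)) := by
  funext i
  refine Fin.addCases (fun i => ?_) (fun i => ?_) i
  · simp [wordPrefix]
  · simp [wordPrefix, shift_iterate, add_comm]

theorem cylinderSet_append {m n : ℕ} (u : Fin m → A) (v : Fin n → A) :
    cylinderSet (Fin.append u v) = cylinderSet u ∩ shift^[m] ⁻¹' cylinderSet v := by
  ext x
  simp only [cylinderSet, mem_ofPred_eq, mem_inter_iff, mem_preimage, shift_iterate]
  constructor
  · intro h
    refine ⟨fun i => by simpa using h (Fin.castAdd n i), fun i => ?_⟩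
    simpa [add_comm] using h (Fin.natAdd m i)
  · rintro ⟨h1, h2⟩ i
    refine Fin.addCases (fun i => ?_) (fun i => ?_) i
    · simpa using h1 i
    · simpa [add_comm] using h2 i

variable [MeasurableSpace A]

theorem measurable_wordPrefix (n : ℕ) : Measurable (wordPrefix (A := A) n) :=
  measurable_pi_lambda _ fun _ => measurable_pi_apply _

theorem measurable_shift : Measurable (shift (A := A)) :=
  measurable_pi_lambda _ fun _ => measurable_pi_apply _

theorem integral_birkhoffSum {ν : Measure (ℕ → A)} (hν : IsInvariantProb ν) {f : (ℕ → A) → ℝ}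
    (hf : Integrable f ν) (n : ℕ) :
    Integrable (birkhoffSum shift f n) ν ∧ ∫ x, birkhoffSum shift f n x ∂ν = n * ∫ x, f x ∂ν := by
  have hi : ∀ k, Integrable (fun x => f (shift^[k] x)) ν := fun k =>
    (hν.2.iterate k).integrable_comp_of_integrable hf
  have he : ∀ k, ∫ x, f (shift^[k] x) ∂ν = ∫ x, f x ∂ν := by
    intro k
    have hk := hν.2.iterate k
    have h := integral_map (μ := ν) hk.measurable.aemeasurable
      (hk.map_eq.symm ▸ hf.aestronglyMeasurable)
    rw [hk.map_eq] at h
    exact h.symm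
  unfold birkhoffSum
  refine ⟨integrable_finsetSum _ fun k _ => hi k, ?_⟩
  rw [integral_finsetSum _ fun k _ => hi k]
  simp [he]

theorem blockEntropy_nonneg [Fintype A] (ν : Measure (ℕ → A)) [IsProbabilityMeasure ν] (n : ℕ) :
    0 ≤ blockEntropy ν n :=
  Finset.sum_nonneg fun _ _ => Real.negMulLog_nonneg measureReal_nonneg measureReal_le_one

variable [MeasurableSingletonClass A]

theorem measurableSet_cylinderSet {n : ℕ} (w : Fin n → A) : MeasurableSet (cylinderSet w) := by
  rw [cylinderSet_eq_preimage]
  exact measurable_wordPrefix n (measurableSet_singleton w)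

variable [Fintype A]

theorem integrable_comp_wordPrefix (ν : Measure (ℕ → A)) [IsFiniteMeasure ν] {n : ℕ}
    (F : (Fin n → A) → ℝ) : Integrable (fun x => F (wordPrefix n x)) ν := by
  have : Integrable F (ν.map (wordPrefix n)) := Integrable.of_finite
  exact this.comp_measurable (measurable_wordPrefix n)

theorem integral_comp_wordPrefix (ν : Measure (ℕ → A)) [IsFiniteMeasure ν] {n : ℕ}
    (F : (Fin n → A) → ℝ) :
    ∫ x, F (wordPrefix n x) ∂ν = ∑ w, ν.real (cylinderSet w) * F w := by
  have hF : Integrable F (ν.map (wordPrefix n)) := Integrable.of_finite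
  rw [← integral_map (measurable_wordPrefix n).aemeasurable hF.aestronglyMeasurable,
    integral_fintype hF]
  refine Finset.sum_congr rfl fun w _ => ?_
  rw [smul_eq_mul, map_measureReal_apply (measurable_wordPrefix n) (measurableSet_singleton w),
    cylinderSet_eq_preimage]

theorem sum_measureReal_cylinderSet (ν : Measure (ℕ → A)) [IsProbabilityMeasure ν] (n : ℕ) :
    ∑ w : Fin n → A, ν.real (cylinderSet w) = 1 := by
  have := integral_comp_wordPrefix ν (n := n) (fun _ => 1)
  simpa using this.symm

theorem blockEntropy_eq_integral (ν : Measure (ℕ → A)) [IsFiniteMeasure ν] (n : ℕ) :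
    blockEntropy ν n = ∫ x, -Real.log (ν.real (cylinderSet (wordPrefix n x))) ∂ν := by
  rw [integral_comp_wordPrefix ν (fun w => -Real.log (ν.real (cylinderSet w)))]
  simp [blockEntropy, Real.negMulLog]

theorem blockEntropy_le_integral (ν : Measure (ℕ → A)) [IsProbabilityMeasure ν] {n : ℕ}
    {q : (Fin n → A) → ℝ} (hq : ∀ w, 0 ≤ q w) (hsum : ∑ w, q w = 1)
    (h0 : ∀ w, q w = 0 → ν.real (cylinderSet w) = 0) :
    blockEntropy ν n ≤ ∫ x, -Real.log (q (wordPrefix n x)) ∂ν := by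
  rw [integral_comp_wordPrefix ν (fun w => -Real.log (q w))]
  refine sum_negMulLog_le_of_sum_le _ (fun _ _ => measureReal_nonneg) (fun w _ => hq w)
    (fun w _ => h0 w) ?_
  rw [hsum, sum_measureReal_cylinderSet]

/-- Gibbs' inequality against the law `q` that makes the first m and the next n letters independent:
its cross-entropy is H_m + H_n by invariance. -/
theorem blockEntropy_subadditive {ν : Measure (ℕ → A)} (hν : IsInvariantProb ν) :
    Subadditive (blockEntropy ν) := by
  intro m n
  have := hν.1
  have hm : MeasurePreserving (shift^[m]) ν ν := hν.2.iterate m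
  let q : (Fin (m + n) → A) → ℝ := fun w =>
    ν.real (cylinderSet fun i => w (Fin.castAdd n i)) *
      ν.real (cylinderSet fun i => w (Fin.natAdd m i))
  have hq : ∀ u v, q (Fin.append u v) = ν.real (cylinderSet u) * ν.real (cylinderSet v) := by
    intro u v; simp [q]
  have hsum : ∑ w, q w = 1 := by
    rw [← (Fin.appendEquiv m n).sum_comp, Fintype.sum_prod_type]
    simp only [Fin.appendEquiv, Equiv.coe_fn_mk, hq]
    simp_rw [← Finset.mul_sum, sum_measureReal_cylinderSet, mul_one]
    exact sum_measureReal_cylinderSet ν m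
  have h0 : ∀ w, q w = 0 → ν.real (cylinderSet w) = 0 := by
    intro w
    obtain ⟨⟨u, v⟩, rfl⟩ := (Fin.appendEquiv m n).surjective w
    simp only [Fin.appendEquiv, Equiv.coe_fn_mk, hq]
    rw [cylinderSet_append]
    intro h
    rcases mul_eq_zero.1 h with h | h
    · exact le_antisymm (h ▸ measureReal_mono inter_subset_left) measureReal_nonneg
    · rw [← hm.measureReal_preimage (measurableSet_cylinderSet v).nullMeasurableSet] at h
      exact le_antisymm (h ▸ measureReal_mono inter_subset_right) measureReal_nonneg
  refine (blockEntropy_le_integral ν (fun w => by positivity) hsum h0).trans_eq ?_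
  -- The logarithm of a product splits only for nonzero factors; prefixes of zero mass occur on a
  -- null set.
  have hpos : ∀ k, ∀ᵐ x ∂ν, ν.real (cylinderSet (wordPrefix k x)) ≠ 0 := by
    intro k
    have : ∫ x, (if ν.real (cylinderSet (wordPrefix k x)) = 0 then (1 : ℝ) else 0) ∂ν = 0 := by
      rw [integral_comp_wordPrefix ν (fun w => if ν.real (cylinderSet w) = 0 then (1 : ℝ) else 0)]
      exact Finset.sum_eq_zero fun w _ => by split_ifs with h <;> simp [h]
    rw [integral_eq_zero_iff_of_nonneg (fun x => by dsimp only; split_ifs <;> simp)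
      (integrable_comp_wordPrefix ν
        (fun w => if ν.real (cylinderSet w) = 0 then (1 : ℝ) else 0))] at this
    filter_upwards [this] with x hx h
    simp [h] at hx
  have hsplit : ∀ᵐ x ∂ν, -Real.log (q (wordPrefix (m + n) x)) =
      -Real.log (ν.real (cylinderSet (wordPrefix m x))) +
        -Real.log (ν.real (cylinderSet (wordPrefix n (shift^[m] x)))) := by
    filter_upwards [hpos m, hm.quasiMeasurePreserving.ae (hpos n)] with x h1 h2
    rw [wordPrefix_add, hq, Real.log_mul h1 h2]
    ring
  have hi := integrable_comp_wordPrefix ν (n := n) fun w => -Real.log (ν.real (cylinderSet w))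
  have hi' : Integrable
      (fun x => -Real.log (ν.real (cylinderSet (wordPrefix n (shift^[m] x))))) ν :=
    hm.integrable_comp_of_integrable hi
  rw [integral_congr_ae hsplit, integral_add
    (integrable_comp_wordPrefix ν fun w => -Real.log (ν.real (cylinderSet w))) hi', blockEntropy_eq_integral, blockEntropy_eq_integral]
  congr 1
  have h := integral_map (μ := ν) hm.measurable.aemeasurable
    (hm.map_eq.symm ▸ hi.aestronglyMeasurable)
  rw [hm.map_eq] at h
  exact h.symm

/-- Fekete's lemma: the limit exists, so the `limUnder` in the definition is a genuine limit. -/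
theorem tendsto_blockEntropy_div {ν : Measure (ℕ → A)} (hν : IsInvariantProb ν) :
    Tendsto (fun n : ℕ => blockEntropy ν n / n) atTop (𝓝 (shiftEntropy ν)) := by
  have := hν.1
  refine tendsto_nhds_limUnder ⟨_, (blockEntropy_subadditive hν).tendsto_lim ⟨0, ?_⟩⟩
  rintro _ ⟨n, rfl⟩
  exact div_nonneg (blockEntropy_nonneg ν n) n.cast_nonneg

/-- If positive weights on words satisfy a weak lower Gibbs bound for `f`, then
`h(ν) + ⟨f, ν⟩ ≤ 0` for every invariant `ν`. -/
theorem shiftEntropy_add_integral_nonpos {ν : Measure (ℕ → A)} (hν : IsInvariantProb ν)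
    {f : (ℕ → A) → ℝ} (hf : Integrable f ν) {q : (n : ℕ) → (Fin n → A) → ℝ}
    (hq : ∀ n w, 0 < q n w) (hsum : ∀ n, ∑ w, q n w = 1) {e : ℕ → ℝ}
    (he : Tendsto (fun n : ℕ => e n / n) atTop (𝓝 0))
    (hqe : ∀ n x, birkhoffSum shift f n x - e n ≤ Real.log (q n (wordPrefix n x))) :
    shiftEntropy ν + ∫ x, f x ∂ν ≤ 0 := by
  have := hν.1
  have key : ∀ n : ℕ, blockEntropy ν n ≤ e n - n * ∫ x, f x ∂ν := by
    intro n
    refine (blockEntropy_le_integral ν (fun w => (hq n w).le) (hsum n)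
      fun w h => absurd h (hq n w).ne').trans ?_
    obtain ⟨h1, h2⟩ := integral_birkhoffSum hν hf n
    have h3 : ∫ x, (e n - birkhoffSum shift f n x) ∂ν = e n - n * ∫ x, f x ∂ν := by
      rw [integral_sub (integrable_const _) h1, h2]; simp
    rw [← h3]
    refine integral_mono (integrable_comp_wordPrefix ν fun w => -Real.log (q n w))
      ((integrable_const _).sub h1) fun x => ?_
    have := hqe n x
    dsimp only
    linarith
  have hlim := he.sub_const (∫ x, f x ∂ν)
  have hle := le_of_tendsto_of_tendsto (tendsto_blockEntropy_div hν) hlim (by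
    filter_upwards [eventually_gt_atTop 0] with n hn
    have hn' : (0 : ℝ) < n := by exact_mod_cast hn
    rw [div_le_iff₀ hn', sub_mul, div_mul_cancel₀ _ hn'.ne', mul_comm (∫ x, f x ∂ν)]
    exact key n)
  linarith

/-- An invariant measure with a weak upper Gibbs bound for `f` satisfies `0 ≤ h(ν) + ⟨f, ν⟩`. -/
theorem shiftEntropy_add_integral_nonneg {ν : Measure (ℕ → A)} (hν : IsInvariantProb ν)
    {f : (ℕ → A) → ℝ} (hf : Integrable f ν) {e : ℕ → ℝ}
    (he : Tendsto (fun n : ℕ => e n / n) atTop (𝓝 0))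
    (hqe : ∀ n x, Real.log (ν.real (cylinderSet (wordPrefix n x))) ≤
      birkhoffSum shift f n x + e n) :
    0 ≤ shiftEntropy ν + ∫ x, f x ∂ν := by
  have := hν.1
  have key : ∀ n : ℕ, -e n - n * ∫ x, f x ∂ν ≤ blockEntropy ν n := by
    intro n
    obtain ⟨h1, h2⟩ := integral_birkhoffSum hν hf n
    have h3 : ∫ x, (-e n - birkhoffSum shift f n x) ∂ν = -e n - n * ∫ x, f x ∂ν := by
      rw [integral_sub (integrable_const _) h1, h2]; simp
    rw [← h3, blockEntropy_eq_integral]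
    refine integral_mono ((integrable_const _).sub h1)
      (integrable_comp_wordPrefix ν fun w => -Real.log (ν.real (cylinderSet w))) fun x => ?_
    have := hqe n x
    dsimp only
    linarith
  have hlim := he.neg.sub_const (∫ x, f x ∂ν)
  have hle := le_of_tendsto_of_tendsto hlim (tendsto_blockEntropy_div hν) (by
    filter_upwards [eventually_gt_atTop 0] with n hn
    have hn' : (0 : ℝ) < n := by exact_mod_cast hn
    rw [le_div_iff₀ hn', sub_mul, neg_mul, div_mul_cancel₀ _ hn'.ne', mul_comm (∫ x, f x ∂ν)]
    exact key n)
  linarith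

/-- Finite measures on `A^ℕ` that agree on cylinder sets are equal. -/
theorem ext_of_cylinderSet {μ ν : Measure (ℕ → A)} [IsFiniteMeasure μ] [IsFiniteMeasure ν]
    (h : ∀ n (w : Fin n → A), μ.real (cylinderSet w) = ν.real (cylinderSet w)) : μ = ν := by
  have hpre : ∀ n, μ.map (wordPrefix n) = ν.map (wordPrefix n) := by
    intro n
    refine Measure.ext_of_singleton fun w => ?_
    rw [Measure.map_apply (measurable_wordPrefix n) (measurableSet_singleton w),
      Measure.map_apply (measurable_wordPrefix n) (measurableSet_singleton w),
      ← cylinderSet_eq_preimage]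
    exact (measureReal_eq_measureReal_iff).1 (h n w)
  -- Any finite set of coordinates lies in a prefix, so prefix marginals determine all finite
  -- marginals.
  have hproj : ∀ I : Finset ℕ, μ.map I.restrict = ν.map I.restrict := by
    intro I
    obtain ⟨N, hN⟩ := I.exists_nat_subset_range
    let r : (Fin N → A) → (I → A) := fun w i => w ⟨i, Finset.mem_range.1 (hN i.2)⟩
    have hr : Measurable r := measurable_pi_lambda _ fun _ => measurable_pi_apply _
    have hc : (I.restrict : (ℕ → A) → (I → A)) = r ∘ wordPrefix N := rfl
    rw [hc, ← Measure.map_map hr (measurable_wordPrefix N), hpre,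
      Measure.map_map hr (measurable_wordPrefix N)]
  exact IsProjectiveLimit.unique (P := fun I => ν.map I.restrict) hproj fun _ => rfl

end Entropy

/-! ### Measures with prescribed cylinder masses, as images of Lebesgue measure -/

section BinaryCoding

/-- The left endpoint of the interval coded by a word, where `m` gives the lengths of the intervals.
Words are read from the right: the last letter is the head of the list. -/
def codeLeft (m : List (Fin 2) → ℝ) : List (Fin 2) → ℝ
  | [] => 0
  | c :: l => if c = 0 then codeLeft m l else codeLeft m l + m (0 :: l)

/-- The letter that follows the word `l` in the coding of `t`. -/
noncomputable def codeLetter (m : List (Fin 2) → ℝ) (t : ℝ) (l : List (Fin 2)) : Fin 2 :=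
  if t < codeLeft m l + m (0 :: l) then 0 else 1

/-- The first `n` letters of the coding of `t`, in reversed order. -/
noncomputable def codeWord (m : List (Fin 2) → ℝ) (t : ℝ) : ℕ → List (Fin 2)
  | 0 => []
  | n + 1 => codeLetter m t (codeWord m t n) :: codeWord m t n

/-- The coding of the points of the unit interval by binary sequences. -/
noncomputable def codeSeq (m : List (Fin 2) → ℝ) (t : ℝ) (n : ℕ) : Fin 2 :=
  codeLetter m t (codeWord m t n)

theorem reverse_codeWord (m : List (Fin 2) → ℝ) (t : ℝ) (n : ℕ) :
    (codeWord m t n).reverse = List.ofFn (wordPrefix n (codeSeq m t)) := by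
  induction n with
  | zero => rfl
  | succ n ih =>
    rw [codeWord, List.reverse_cons, ih, List.ofFn_succ_last]
    rfl

/-- The interval of `l` is cut at `codeLeft m l + m (0 :: l)` into the intervals of its two
extensions; half-open intervals make this an exact partition. -/
theorem codeWord_eq_iff {m : List (Fin 2) → ℝ} (hm : ∀ l, 0 ≤ m l) (hm1 : m [] = 1)
    (hadd : ∀ l, m (0 :: l) + m (1 :: l) = m l) {t : ℝ} (ht : t ∈ Ico (0 : ℝ) 1)
    (l : List (Fin 2)) :
    codeWord m t l.length = l ↔ t ∈ Ico (codeLeft m l) (codeLeft m l + m l) := by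
  induction l with
  | nil => simpa [codeWord, codeLeft, hm1] using ht
  | cons c l ih =>
    have h1 : codeWord m t (c :: l).length = c :: l ↔
        codeWord m t l.length = l ∧ codeLetter m t l = c := by
      rw [List.length_cons, codeWord, List.cons_eq_cons]
      constructor
      · rintro ⟨h, h'⟩; exact ⟨h', by rw [← h, h']⟩
      · rintro ⟨h, h'⟩; exact ⟨by rw [h, h'], h⟩
    rw [h1, ih]
    have h0 := hm (0 :: l)
    have h2 := hm (1 :: l)
    have h3 := hadd l
    simp only [mem_Ico, codeLetter]
    obtain rfl | rfl : c = 0 ∨ c = 1 := by fin_cases c <;> simp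
    · simp only [codeLeft, if_true]
      split_ifs with h
      · simp only [and_true]; constructor <;> rintro ⟨_, _⟩ <;> constructor <;> linarith
      · simp only [one_ne_zero, and_false, false_iff]; tauto
    · simp only [codeLeft, one_ne_zero, if_false]
      split_ifs with h
      · simp only [zero_ne_one, and_false, false_iff, not_and]; intro _; linarith
      · simp only [and_true]; constructor <;> rintro ⟨_, _⟩ <;> constructor <;> linarith

theorem codeLeft_mem {m : List (Fin 2) → ℝ} (hm : ∀ l, 0 ≤ m l) (hm1 : m [] = 1)
    (hadd : ∀ l, m (0 :: l) + m (1 :: l) = m l) (l : List (Fin 2)) :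
    0 ≤ codeLeft m l ∧ codeLeft m l + m l ≤ 1 := by
  induction l with
  | nil => simp [codeLeft, hm1]
  | cons c l ih =>
    have h0 := hm (0 :: l)
    have h2 := hm (1 :: l)
    have h3 := hadd l
    obtain rfl | rfl : c = 0 ∨ c = 1 := by fin_cases c <;> simp
    · simp only [codeLeft, if_true]; constructor <;> linarith
    · simp only [codeLeft, one_ne_zero, if_false]; constructor <;> linarith

/-- There are countably many words, so it suffices to treat fibres, which are finite intersections
of half-lines. -/
theorem measurable_codeWord {m : List (Fin 2) → ℝ} (n : ℕ) :
    Measurable[_, ⊤] (fun t => codeWord m t n) := by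
  induction n with
  | zero => exact measurable_const
  | succ n ih =>
    let _ : MeasurableSpace (List (Fin 2)) := ⊤
    refine measurable_to_countable' fun l => ?_
    cases l with
    | nil => simp [preimage, codeWord]
    | cons c l =>
      have : (fun t => codeWord m t (n + 1)) ⁻¹' {c :: l} =
          (fun t => codeWord m t n) ⁻¹' {l} ∩ (fun t => codeLetter m t l) ⁻¹' {c} := by
        ext t
        simp only [mem_preimage, mem_singleton_iff, codeWord, List.cons_eq_cons, mem_inter_iff]
        constructor
        · rintro ⟨h, h'⟩; exact ⟨h', by rw [← h, h']⟩
        · rintro ⟨h, h'⟩; exact ⟨by rw [h, h'], h⟩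
      rw [this]
      refine (ih (MeasurableSpace.measurableSet_top)).inter ?_
      have : Measurable (fun t => codeLetter m t l) :=
        Measurable.ite measurableSet_Iio measurable_const measurable_const
      exact this (measurableSet_singleton c)

theorem measurable_codeSeq {m : List (Fin 2) → ℝ} : Measurable (codeSeq m) := by
  refine measurable_pi_lambda _ fun n => ?_
  have h : (fun t => codeSeq m t n) =
      (fun l : List (Fin 2) => l.headD 0) ∘ fun t => codeWord m t (n + 1) := rfl
  rw [h]
  exact (measurable_from_top (f := fun l : List (Fin 2) => l.headD 0)).comp
    (measurable_codeWord (n + 1))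

/-- Consistent weights on binary words are the cylinder masses of a probability measure. -/
theorem exists_measure_of_consistent {W : List (Fin 2) → ℝ} (hW : ∀ l, 0 ≤ W l) (hW1 : W [] = 1)
    (hadd : ∀ l, W (l ++ [0]) + W (l ++ [1]) = W l) :
    ∃ μ : Measure (ℕ → Fin 2), IsProbabilityMeasure μ ∧
      ∀ n (w : Fin n → Fin 2), μ.real (cylinderSet w) = W (List.ofFn w) := by
  -- The coding puts each new letter at the head of the list, whereas `W` reads words from left to
  -- right.
  let m : List (Fin 2) → ℝ := fun l => W l.reverse
  have hm : ∀ l, 0 ≤ m l := fun l => hW _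
  have hm1 : m [] = 1 := hW1
  have hmadd : ∀ l, m (0 :: l) + m (1 :: l) = m l := fun l => by
    simpa [m] using hadd l.reverse
  let P : Measure ℝ := volume.restrict (Ico 0 1)
  have hP : IsProbabilityMeasure P := ⟨by simp [P]⟩
  refine ⟨P.map (codeSeq m), Measure.isProbabilityMeasure_map measurable_codeSeq.aemeasurable,
    fun n w => ?_⟩
  rw [map_measureReal_apply measurable_codeSeq (measurableSet_cylinderSet w),
    measureReal_restrict_apply (measurable_codeSeq (measurableSet_cylinderSet w))]
  set l := (List.ofFn w).reverse with hl
  have hlen : l.length = n := by simp [hl]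
  have hset : codeSeq m ⁻¹' cylinderSet w ∩ Ico 0 1 = Ico (codeLeft m l) (codeLeft m l + m l) := by
    ext t
    have hcyl : t ∈ codeSeq m ⁻¹' cylinderSet w ↔ codeWord m t l.length = l := by
      rw [cylinderSet_eq_preimage, hlen, hl, ← List.reverse_inj, reverse_codeWord,
        List.reverse_reverse, List.ofFn_inj]
      rfl
    rw [mem_inter_iff, hcyl]
    constructor
    · rintro ⟨h, ht⟩
      exact (codeWord_eq_iff hm hm1 hmadd ht l).1 h
    · intro h
      obtain ⟨h0, h1⟩ := codeLeft_mem hm hm1 hmadd l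
      have ht : t ∈ Ico (0 : ℝ) 1 := ⟨h0.trans h.1, h.2.trans_le h1⟩
      exact ⟨(codeWord_eq_iff hm hm1 hmadd ht l).2 h, ht⟩
  rw [hset, Real.volume_real_Ico_of_le (by linarith [hm l])]
  simp [m, hl]

/-- If the weights are moreover consistent on the left, then the measure is shift invariant. -/
theorem exists_isInvariantProb_of_consistent {W : List (Fin 2) → ℝ} (hW : ∀ l, 0 ≤ W l)
    (hW1 : W [] = 1) (hright : ∀ l, W (l ++ [0]) + W (l ++ [1]) = W l)
    (hleft : ∀ l, W (0 :: l) + W (1 :: l) = W l) :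
    ∃ μ : Measure (ℕ → Fin 2), IsInvariantProb μ ∧
      ∀ n (w : Fin n → Fin 2), μ.real (cylinderSet w) = W (List.ofFn w) := by
  obtain ⟨μ, hμ, hcyl⟩ := exists_measure_of_consistent hW hW1 hright
  refine ⟨μ, ⟨hμ, measurable_shift, ?_⟩, hcyl⟩
  have := Measure.isProbabilityMeasure_map (μ := μ) measurable_shift.aemeasurable
  refine ext_of_cylinderSet fun n w => ?_
  rw [map_measureReal_apply measurable_shift (measurableSet_cylinderSet w)]
  have hsplit : shift ⁻¹' cylinderSet w =
      cylinderSet (Fin.cons 0 w : Fin (n + 1) → Fin 2) ∪ cylinderSet (Fin.cons 1 w) := by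
    ext x
    have : x 0 = 0 ∨ x 0 = 1 := by generalize x 0 = c; fin_cases c <;> simp
    simp only [cylinderSet, mem_preimage, mem_ofPred_eq, shift, mem_union, Fin.forall_fin_succ,
      Fin.cons_zero, Fin.cons_succ, Fin.val_zero, Fin.val_succ]
    tauto
  have hdisj : Disjoint (cylinderSet (Fin.cons 0 w : Fin (n + 1) → Fin 2))
      (cylinderSet (Fin.cons 1 w)) := by
    rw [Set.disjoint_left]
    intro x h0 h1
    have e0 := h0 0
    have e1 := h1 0
    simp only [Fin.cons_zero] at e0 e1
    exact zero_ne_one (e0.symm.trans e1)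
  rw [hsplit, measureReal_union hdisj (measurableSet_cylinderSet _), hcyl, hcyl, hcyl,
    List.ofFn_cons, List.ofFn_cons, hleft]

end BinaryCoding

/-! ### Word probabilities of the stationary renewal process -/

section Renewal

/-- The probabilities of words in a stationary renewal process: `p` is the law of the length of a
block of ones between consecutive zeros, `q` its tail, and `T` the tail sums of `q`. -/
noncomputable def renewalWeight (p q T : ℕ → ℝ) : List (Fin 2) → ℝ
  | [] => 1
  | c :: l =>
    if 0 ∈ l then
      renewalWeight p q T l *
        (if c = 0 then p (l.idxOf 0) / q (l.idxOf 0) else q (l.idxOf 0 + 1) / q (l.idxOf 0))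
    else (if c = 0 then q l.length else T (l.length + 1)) / T 0

variable {p q T : ℕ → ℝ}

theorem renewalWeight_cons_of_mem {c : Fin 2} {l : List (Fin 2)} (h : 0 ∈ l) :
    renewalWeight p q T (c :: l) = renewalWeight p q T l *
      (if c = 0 then p (l.idxOf 0) / q (l.idxOf 0) else q (l.idxOf 0 + 1) / q (l.idxOf 0)) := by
  rw [renewalWeight, if_pos h]

theorem renewalWeight_cons_of_notMem {c : Fin 2} {l : List (Fin 2)} (h : 0 ∉ l) :
    renewalWeight p q T (c :: l) = (if c = 0 then q l.length else T (l.length + 1)) / T 0 := by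
  rw [renewalWeight, if_neg h]

theorem renewalWeight_pos (hp : ∀ k, 0 < p k) (hq : ∀ k, 0 < q k) (hT : ∀ k, 0 < T k)
    (l : List (Fin 2)) : 0 < renewalWeight p q T l := by
  induction l with
  | nil => simp [renewalWeight]
  | cons c l ih =>
    by_cases h : 0 ∈ l
    · rw [renewalWeight_cons_of_mem h]
      refine mul_pos ih ?_
      split_ifs
      · exact div_pos (hp _) (hq _)
      · exact div_pos (hq _) (hq _)
    · rw [renewalWeight_cons_of_notMem h]
      refine div_pos ?_ (hT 0)
      split_ifs
      · exact hq _
      · exact hT _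

theorem renewalWeight_of_notMem (hT : ∀ k, 0 < T k) {l : List (Fin 2)} (h : 0 ∉ l) :
    renewalWeight p q T l = T l.length / T 0 := by
  cases l with
  | nil => simp [renewalWeight, (hT 0).ne']
  | cons c l =>
    rw [List.mem_cons, not_or] at h
    rw [renewalWeight_cons_of_notMem h.2, if_neg (Ne.symm h.1), List.length_cons]

/-- Starting from q_0/T_0, the factors q_{j+1}/q_j telescope. -/
theorem renewalWeight_append_zero (hq : ∀ k, 0 < q k) {l : List (Fin 2)} (h : 0 ∉ l) :
    renewalWeight p q T (l ++ [0]) = q l.length / T 0 := by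
  induction l with
  | nil => simp [renewalWeight]
  | cons c l ih =>
    rw [List.mem_cons, not_or] at h
    rw [List.cons_append, renewalWeight_cons_of_mem (by simp), ih h.2, if_neg (Ne.symm h.1),
      List.idxOf_append_of_notMem h.2, List.length_cons]
    have := (hq l.length).ne'
    simp
    field_simp

/-- A word with first zero at index J shows a run of at least J ones, an event of probability q_J.
The letter to its left is 0 exactly when the run has length J, so the conditional probabilities
p_J/q_J and q_{J+1}/q_J add up to 1. -/
theorem renewalWeight_left (hq : ∀ k, 0 < q k) (hT : ∀ k, 0 < T k)
    (hqp : ∀ k, q k = p k + q (k + 1)) (hTq : ∀ k, T k = q k + T (k + 1)) (l : List (Fin 2)) :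
    renewalWeight p q T (0 :: l) + renewalWeight p q T (1 :: l) = renewalWeight p q T l := by
  by_cases h : 0 ∈ l
  · rw [renewalWeight_cons_of_mem h, renewalWeight_cons_of_mem h, ← mul_add, if_pos rfl,
      if_neg one_ne_zero, ← add_div, ← hqp, div_self (hq _).ne', mul_one]
  · rw [renewalWeight_cons_of_notMem h, renewalWeight_cons_of_notMem h, if_pos rfl,
      if_neg one_ne_zero, ← add_div, ← hTq, renewalWeight_of_notMem hT h]

/-- If `l` contains a zero, the factor for `c` does not see the appended letter and induction
applies. Otherwise `l` consists of ones, and the claim reduces to the recurrence for q (if c = 0) or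
for T (if c = 1). -/
theorem renewalWeight_right (hq : ∀ k, 0 < q k) (hT : ∀ k, 0 < T k)
    (hqp : ∀ k, q k = p k + q (k + 1)) (hTq : ∀ k, T k = q k + T (k + 1)) (l : List (Fin 2)) :
    renewalWeight p q T (l ++ [0]) + renewalWeight p q T (l ++ [1]) = renewalWeight p q T l := by
  induction l with
  | nil => simpa using renewalWeight_left hq hT hqp hTq []
  | cons c l ih =>
    by_cases h : 0 ∈ l
    · rw [List.cons_append, List.cons_append, renewalWeight_cons_of_mem (by simp [h]),
        renewalWeight_cons_of_mem (by simp [h]), renewalWeight_cons_of_mem h,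
        List.idxOf_append_of_mem h, List.idxOf_append_of_mem h, ← add_mul, ih]
    · have h1 : 0 ∉ l ++ [(1 : Fin 2)] := by simp [h]
      rw [List.cons_append, List.cons_append, renewalWeight_cons_of_mem (by simp),
        renewalWeight_cons_of_notMem h1, renewalWeight_append_zero hq h,
        renewalWeight_cons_of_notMem h, List.idxOf_append_of_notMem h]
      have h2 := (hq l.length).ne'
      have h3 := (hT 0).ne'
      simp only [List.idxOf_cons_self, add_zero, List.length_append, List.length_cons,
        List.length_nil, zero_add]
      split_ifs
      · have := hqp l.length
        field_simp
        linarith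
      · have := hTq (l.length + 1)
        field_simp
        linarith

/-- The tail sums of a positive summable sequence are positive, and `q_k = p_k + q_{k+1}`. -/
theorem tail_sums_pos_and_recurrence (hp : ∀ k, 0 < p k) (hs : Summable p) :
    (∀ k, 0 < ∑' i, p (i + k)) ∧ (∀ k, ∑' i, p (i + k) = p k + ∑' i, p (i + (k + 1))) := by
  have hk : ∀ k, Summable fun i => p (i + k) := fun k => (summable_nat_add_iff k).2 hs
  refine ⟨fun k => (hk k).tsum_pos (fun i => (hp _).le) 0 (hp _), fun k => ?_⟩
  rw [(hk k).tsum_eq_zero_add]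
  simp only [zero_add, add_assoc, add_comm 1 k]

/-- Tonelli for p_{i+j} on ℕ × ℕ: the antidiagonal i + j = n contributes (n+1)p_n. -/
theorem summable_tail_sums (hp : ∀ k, 0 < p k) (hs : Summable fun k : ℕ => ((k : ℝ) + 1) * p k) :
    Summable fun k => ∑' i, p (i + k) := by
  have h1 : Summable fun x : (Σ n : ℕ, Finset.HasAntidiagonal.antidiagonal n) => p x.1 := by
    refine (summable_sigma_of_nonneg fun x => (hp _).le).2 ⟨fun n => Summable.of_finite, ?_⟩
    refine hs.congr fun n => ?_
    simp
  have h2 : Summable fun x : ℕ × ℕ => p (x.2 + x.1) := by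
    rw [← Finset.HasAntidiagonal.sigmaAntidiagonalEquivProd.summable_iff]
    refine h1.congr fun x => ?_
    obtain ⟨n, ⟨⟨i, j⟩, h⟩⟩ := x
    rw [Finset.HasAntidiagonal.mem_antidiagonal] at h
    simp only [Function.comp, Finset.HasAntidiagonal.sigmaAntidiagonalEquivProd_apply]
    rw [← h, add_comm]
  exact h2.prod

end Renewal

/-! ### The Hofbauer potential and the weak Gibbs property -/

section Hofbauer

variable {a : ℕ → ℝ}

theorem fin_two_eq_one {c : Fin 2} (h : c ≠ 0) : c = 1 := by
  fin_cases c
  · exact absurd rfl h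
  · rfl

theorem ofFn_wordPrefix_succ (n : ℕ) (x : ℕ → Fin 2) :
    List.ofFn (wordPrefix (n + 1) x) = x 0 :: List.ofFn (wordPrefix n (shift x)) := by
  rw [List.ofFn_succ]; rfl

theorem mem_hofbauerSet_zero {x : ℕ → Fin 2} (h : x 0 = 0) : x ∈ hofbauerSet 0 :=
  ⟨fun i hi => absurd hi (Nat.not_lt_zero i), h⟩

theorem mem_hofbauerSet_succ {x : ℕ → Fin 2} {k : ℕ} (h : x 0 = 1) (hx : shift x ∈ hofbauerSet k) :
    x ∈ hofbauerSet (k + 1) := by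
  refine ⟨fun i hi => ?_, hx.2⟩
  cases i with
  | zero => exact h
  | succ i => exact hx.1 i (by omega)

theorem mem_hofbauerSet_idxOf {n : ℕ} {x : ℕ → Fin 2} (h : 0 ∈ List.ofFn (wordPrefix n x)) :
    x ∈ hofbauerSet ((List.ofFn (wordPrefix n x)).idxOf 0) := by
  induction n generalizing x with
  | zero => simp at h
  | succ n ih =>
    rw [ofFn_wordPrefix_succ] at h ⊢
    by_cases h0 : x 0 = 0
    · rw [h0, List.idxOf_cons_self]
      exact mem_hofbauerSet_zero h0
    · rw [List.idxOf_cons_ne _ h0]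
      exact mem_hofbauerSet_succ (fin_two_eq_one h0)
        (ih ((List.mem_cons.1 h).resolve_left (Ne.symm h0)))

theorem eq_one_of_notMem_ofFn {n : ℕ} {x : ℕ → Fin 2} (h : 0 ∉ List.ofFn (wordPrefix n x)) :
    ∀ i < n, x i = 1 := by
  intro i hi
  refine fin_two_eq_one fun h0 => h ?_
  rw [List.mem_ofFn]
  exact ⟨⟨i, hi⟩, h0⟩

theorem eq_ones_or_exists_mem_hofbauerSet (x : ℕ → Fin 2) :
    x = (fun _ => 1) ∨ ∃ k, x ∈ hofbauerSet k := by
  by_cases h : ∃ k, x k = 0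
  · right
    classical
    exact ⟨Nat.find h, fun i hi => fin_two_eq_one (Nat.find_min h hi), Nat.find_spec h⟩
  · left
    push Not at h
    exact funext fun k => fin_two_eq_one (h k)

/-- The supremum of `|a_i|` over `i ≥ k`. -/
noncomputable def tailSup (a : ℕ → ℝ) (k : ℕ) : ℝ := ⨆ i, |a (i + k)|

theorem bddAbove_abs_tail (ha : Tendsto a atTop (𝓝 0)) (k : ℕ) :
    BddAbove (range fun i => |a (i + k)|) := by
  have := ((tendsto_add_atTop_iff_nat k).2 ha).abs.bddAbove_range
  simpa using this

theorem abs_le_tailSup (ha : Tendsto a atTop (𝓝 0)) {k i : ℕ} (h : k ≤ i) :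
    |a i| ≤ tailSup a k := by
  have := le_ciSup (bddAbove_abs_tail ha k) (i - k)
  rwa [Nat.sub_add_cancel h] at this

theorem tailSup_nonneg (a : ℕ → ℝ) (k : ℕ) : 0 ≤ tailSup a k :=
  Real.iSup_nonneg fun _ => abs_nonneg _

theorem tendsto_tailSup (ha : Tendsto a atTop (𝓝 0)) : Tendsto (tailSup a) atTop (𝓝 0) := by
  rw [Metric.tendsto_atTop] at ha ⊢
  intro ε hε
  obtain ⟨N, hN⟩ := ha (ε / 2) (half_pos hε)
  refine ⟨N, fun n hn => ?_⟩
  rw [Real.dist_eq, sub_zero, abs_of_nonneg (tailSup_nonneg a n)]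
  refine (ciSup_le fun i => ?_).trans_lt (half_lt_self hε)
  have := hN (i + n) (by omega)
  rw [Real.dist_eq, sub_zero] at this
  exact this.le

theorem abs_hofbauerPotential_le (ha : Tendsto a atTop (𝓝 0)) {k : ℕ} {x : ℕ → Fin 2}
    (hx : ∀ i < k, x i = 1) : |hofbauerPotential a x| ≤ tailSup a k := by
  rcases eq_ones_or_exists_mem_hofbauerSet x with rfl | ⟨j, hj⟩
  · rw [hofbauerPotential_ones, abs_zero]
    exact tailSup_nonneg a k
  · rw [hofbauerPotential_of_mem a hj]
    refine abs_le_tailSup ha (not_lt.1 fun h => ?_)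
    have := hx j h
    rw [hj.2] at this
    exact zero_ne_one this

theorem hofbauerPotential_nonpos (ha : ∀ k, a k < 0) (x : ℕ → Fin 2) :
    hofbauerPotential a x ≤ 0 := by
  rcases eq_ones_or_exists_mem_hofbauerSet x with rfl | ⟨j, hj⟩
  · rw [hofbauerPotential_ones]
  · rw [hofbauerPotential_of_mem a hj]
    exact (ha j).le

theorem hofbauerPotential_eq_zero_iff (ha : ∀ k, a k < 0) {x : ℕ → Fin 2} :
    hofbauerPotential a x = 0 ↔ x = fun _ => 1 := by
  constructor
  · intro h
    rcases eq_ones_or_exists_mem_hofbauerSet x with hx | ⟨j, hj⟩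
    · exact hx
    · rw [hofbauerPotential_of_mem a hj] at h
      exact absurd h (ha j).ne
  · rintro rfl
    exact hofbauerPotential_ones a

/-- Away from 11… the potential is locally constant; at 11… continuity is the hypothesis a_k → 0. -/
theorem continuous_hofbauerPotential (ha : Tendsto a atTop (𝓝 0)) :
    Continuous (hofbauerPotential a) := by
  have hev : ∀ (x : ℕ → Fin 2) (k : ℕ), ∀ᶠ y in 𝓝 x, ∀ i < k, y i = x i := by
    intro x k
    refine (eventually_all_finite (Set.finite_lt_nat k)).2 fun i _ => ?_
    have hc : Continuous fun y : ℕ → Fin 2 => y i := continuous_apply i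
    exact hc.continuousAt.eventually_mem ((isOpen_discrete ({x i} : Set (Fin 2))).mem_nhds rfl)
  rw [continuous_iff_continuousAt]
  intro x
  rcases eq_ones_or_exists_mem_hofbauerSet x with rfl | ⟨j, hj⟩
  · rw [ContinuousAt, hofbauerPotential_ones, Metric.tendsto_nhds]
    intro ε hε
    obtain ⟨k, hk⟩ := ((tendsto_order.1 (tendsto_tailSup ha)).2 ε hε).exists
    filter_upwards [hev (fun _ => 1) k] with y hy
    rw [Real.dist_eq, sub_zero]
    exact (abs_hofbauerPotential_le ha hy).trans_lt hk
  · refine (continuousAt_const (y := a j)).congr ?_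
    filter_upwards [hev x (j + 1)] with y hy
    refine (hofbauerPotential_of_mem a ⟨fun i hi => ?_, ?_⟩).symm
    · rw [hy i (by omega), hj.1 i hi]
    · rw [hy j (by omega), hj.2]

theorem birkhoffSum_hofbauerPotential_nonpos (ha : ∀ k, a k < 0) (n : ℕ) (x : ℕ → Fin 2) :
    birkhoffSum shift (hofbauerPotential a) n x ≤ 0 :=
  Finset.sum_nonpos fun _ _ => hofbauerPotential_nonpos ha _

/-- A point with i ones still ahead has |φ| ≤ `tailSup a i`; here i runs from n down to 1. The term
i = 0 is slack. -/
theorem neg_sum_tailSup_le_birkhoffSum (ha : Tendsto a atTop (𝓝 0)) {n : ℕ} {x : ℕ → Fin 2}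
    (hx : ∀ i < n, x i = 1) :
    -∑ i ∈ Finset.range (n + 1), tailSup a i ≤ birkhoffSum shift (hofbauerPotential a) n x := by
  induction n generalizing x with
  | zero => simpa using tailSup_nonneg a 0
  | succ n ih =>
    rw [birkhoffSum_succ', Finset.sum_range_succ]
    have h1 := ih (x := shift x) fun i hi => hx (i + 1) (by omega)
    have h2 := (abs_le.1 (abs_hofbauerPotential_le ha hx)).1
    linarith

theorem neg_sum_tailSup_le_sum (ha : Tendsto a atTop (𝓝 0)) (n : ℕ) :
    -∑ i ∈ Finset.range n, tailSup a i ≤ ∑ i ∈ Finset.range n, a i := by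
  rw [← Finset.sum_neg_distrib]
  exact Finset.sum_le_sum fun i _ => (abs_le.1 (abs_le_tailSup ha le_rfl)).1

theorem sum_tailSup_mono (a : ℕ → ℝ) : Monotone fun n => ∑ i ∈ Finset.range n, tailSup a i :=
  fun _ _ h => Finset.sum_le_sum_of_subset_of_nonneg (Finset.range_mono h)
    fun i _ _ => tailSup_nonneg a i

variable {q T : ℕ → ℝ}

/-- The renewal weight of a word with first `0` at the index `J` is, up to a subexponential factor,
`e^{S_n φ} q_J e^{-s_J} / T_0`. -/
theorem abs_log_renewalWeight_sub_le (ha : ∀ k, a k < 0) (ha0 : Tendsto a atTop (𝓝 0))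
    (hq : ∀ k, 0 < q k) (hT : ∀ k, 0 < T k) (hq0 : q 0 = 1) (hq1 : ∀ k, q k ≤ 1)
    (hpq : ∀ k, Real.exp (∑ i ∈ Finset.range (k + 1), a i) ≤ q k) {n J : ℕ} {x : ℕ → Fin 2}
    (h : 0 ∈ List.ofFn (wordPrefix n x)) (hJ : (List.ofFn (wordPrefix n x)).idxOf 0 = J) :
    |Real.log (renewalWeight (fun k => Real.exp (∑ i ∈ Finset.range (k + 1), a i)) q T
        (List.ofFn (wordPrefix n x))) -
      (birkhoffSum shift (hofbauerPotential a) n x + Real.log (q J) -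
        ∑ i ∈ Finset.range (J + 1), a i - Real.log (T 0))| ≤
      ∑ i ∈ Finset.range n, tailSup a i := by
  induction n generalizing x J with
  | zero => simp at h
  | succ n ih =>
    rw [ofFn_wordPrefix_succ] at h hJ ⊢
    rw [birkhoffSum_succ']
    by_cases h' : 0 ∈ List.ofFn (wordPrefix n (shift x))
    · obtain ⟨j, hj⟩ : ∃ j, (List.ofFn (wordPrefix n (shift x))).idxOf 0 = j := ⟨_, rfl⟩
      have hmem := mem_hofbauerSet_idxOf h'
      rw [hj] at hmem
      have hI := ih h' hj
      have hW := (renewalWeight_pos (fun k => Real.exp_pos (∑ i ∈ Finset.range (k + 1), a i)) hq hT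
        (List.ofFn (wordPrefix n (shift x)))).ne'
      rw [renewalWeight_cons_of_mem h', hj]
      have hmono := sum_tailSup_mono a (Nat.le_succ n)
      -- Once a zero lies to the right, prepending a letter changes both compared quantities
      -- equally: by s_j - log q_j for 0 and by log q_{j+1} - log q_j for 1. No new error arises.
      refine (le_trans (le_of_eq ?_) hI).trans hmono
      congr 1
      by_cases h0 : x 0 = 0
      · rw [h0, List.idxOf_cons_self] at hJ
        subst hJ
        rw [if_pos h0, Real.log_mul hW (div_pos (Real.exp_pos _) (hq j)).ne',
          Real.log_div (Real.exp_pos _).ne' (hq j).ne', Real.log_exp,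
          hofbauerPotential_of_mem a (mem_hofbauerSet_zero h0), hq0]
        simp
        ring
      · have h1 := fin_two_eq_one h0
        rw [List.idxOf_cons_ne _ h0, hj] at hJ
        subst hJ
        rw [if_neg h0, Real.log_mul hW (div_pos (hq (j + 1)) (hq j)).ne',
          Real.log_div (hq (j + 1)).ne' (hq j).ne',
          hofbauerPotential_of_mem a (mem_hofbauerSet_succ h1 hmem),
          Finset.sum_range_succ _ (j + 1)]
        ring
    -- The only zero is x_0, and the weight is q_n/T_0. The error is log q_n - S_nφ(σx), where both
    -- terms lie between -∑_{i≤n} `tailSup a i` and 0; it is incurred once, at the rightmost zero.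
    · have h0 : x 0 = 0 := ((List.mem_cons.1 h).resolve_right h').symm
      have hones := eq_one_of_notMem_ofFn h'
      rw [h0, List.idxOf_cons_self] at hJ
      subst hJ
      rw [renewalWeight_cons_of_notMem h', if_pos h0, List.length_ofFn,
        Real.log_div (hq n).ne' (hT 0).ne',
        hofbauerPotential_of_mem a (mem_hofbauerSet_zero h0), hq0]
      have h1 := neg_sum_tailSup_le_birkhoffSum ha0 hones
      have h2 := birkhoffSum_hofbauerPotential_nonpos ha n (shift x)
      have h3 := Real.log_nonpos (hq n).le (hq1 n)
      have h4 := (Real.le_log_iff_exp_le (hq n)).2 (hpq n)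
      have h5 := neg_sum_tailSup_le_sum ha0 (n + 1)
      simp only [zero_add, Finset.range_one, Finset.sum_singleton, Real.log_one]
      rw [abs_le]
      constructor <;> linarith

/-- The weak Gibbs property of the renewal weights. -/
theorem abs_log_renewalWeight_sub_birkhoffSum_le (ha : ∀ k, a k < 0)
    (ha0 : Tendsto a atTop (𝓝 0)) (hq : ∀ k, 0 < q k) (hT : ∀ k, 0 < T k) (hq0 : q 0 = 1)
    (hq1 : ∀ k, q k ≤ 1) (hpq : ∀ k, Real.exp (∑ i ∈ Finset.range (k + 1), a i) ≤ q k)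
    (hqT : ∀ k, q k ≤ T k) (hT0 : ∀ k, T k ≤ T 0) (n : ℕ) (x : ℕ → Fin 2) :
    |Real.log (renewalWeight (fun k => Real.exp (∑ i ∈ Finset.range (k + 1), a i)) q T
        (List.ofFn (wordPrefix n x))) - birkhoffSum shift (hofbauerPotential a) n x| ≤
      2 * ∑ i ∈ Finset.range (n + 1), tailSup a i + Real.log (T 0) := by
  have hlog0 : 0 ≤ Real.log (T 0) := Real.log_nonneg (hq0 ▸ hqT 0)
  by_cases h : 0 ∈ List.ofFn (wordPrefix n x)
  · have hmain := abs_log_renewalWeight_sub_le ha ha0 hq hT hq0 hq1 hpq h rfl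
    have hlt : (List.ofFn (wordPrefix n x)).idxOf 0 < n := by
      simpa using List.idxOf_lt_length_of_mem h
    generalize (List.ofFn (wordPrefix n x)).idxOf 0 = J at *
    -- The leftover log q_J - s_J lies between 0 and -s_J since p_J ≤ q_J ≤ 1; this costs the second
    -- copy of the sum.
    have h1 := sum_tailSup_mono a (Nat.le_succ n)
    have h2 := sum_tailSup_mono a (show J + 1 ≤ n + 1 by omega)
    have h3 := Real.log_nonpos (hq J).le (hq1 J)
    have h4 := (Real.le_log_iff_exp_le (hq J)).2 (hpq J)
    have h5 := neg_sum_tailSup_le_sum ha0 (J + 1)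
    simp only at h1 h2
    rw [abs_le] at hmain ⊢
    constructor <;> linarith [hmain.1, hmain.2]
  · have hones := eq_one_of_notMem_ofFn h
    rw [renewalWeight_of_notMem hT h, List.length_ofFn, Real.log_div (hT n).ne' (hT 0).ne']
    have h1 := neg_sum_tailSup_le_birkhoffSum ha0 hones
    have h2 := birkhoffSum_hofbauerPotential_nonpos ha n x
    have h3 := Real.log_le_log (hT n) (hT0 n)
    have h4 := (Real.le_log_iff_exp_le (hT n)).2 ((hpq n).trans (hqT n))
    have h5 := neg_sum_tailSup_le_sum ha0 (n + 1)
    rw [abs_le]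
    constructor <;> linarith

end Hofbauer

/-! ### The variational inequality and the renewal equilibrium state -/

section Pressure

variable {a : ℕ → ℝ}

theorem integrable_hofbauerPotential (ha : Tendsto a atTop (𝓝 0)) (ν : Measure (ℕ → Fin 2))
    [IsFiniteMeasure ν] : Integrable (hofbauerPotential a) ν :=
  Integrable.of_bound (continuous_hofbauerPotential ha).measurable.aestronglyMeasurable
    (tailSup a 0) (ae_of_all _ fun x => by
      rw [Real.norm_eq_abs]
      exact abs_hofbauerPotential_le ha fun i hi => absurd hi (Nat.not_lt_zero i))

theorem abs_integral_hofbauerPotential_le (ha : Tendsto a atTop (𝓝 0)) (ν : Measure (ℕ → Fin 2))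
    [IsProbabilityMeasure ν] : |∫ x, hofbauerPotential a x ∂ν| ≤ tailSup a 0 := by
  have := norm_integral_le_of_norm_le_const (μ := ν) (f := hofbauerPotential a) (C := tailSup a 0)
    (ae_of_all _ fun x => by
      rw [Real.norm_eq_abs]
      exact abs_hofbauerPotential_le ha fun i hi => absurd hi (Nat.not_lt_zero i))
  simpa using this

theorem integral_hofbauerPotential_nonpos (ha : ∀ k, a k < 0) (ν : Measure (ℕ → Fin 2)) :
    ∫ x, hofbauerPotential a x ∂ν ≤ 0 :=
  integral_nonpos fun x => hofbauerPotential_nonpos ha x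

/-- A nonpositive function with zero integral vanishes almost everywhere, and φ vanishes only at
11…. -/
theorem integral_hofbauerPotential_neg (ha : ∀ k, a k < 0) (ha0 : Tendsto a atTop (𝓝 0))
    {ν : Measure (ℕ → Fin 2)} [IsProbabilityMeasure ν] (hν : ν ≠ Measure.dirac fun _ => 1) :
    ∫ x, hofbauerPotential a x ∂ν < 0 := by
  refine lt_of_le_of_ne (integral_hofbauerPotential_nonpos ha ν) fun h => hν ?_
  have h1 : ∫ x, -hofbauerPotential a x ∂ν = 0 := by rw [integral_neg, h, neg_zero]
  rw [integral_eq_zero_iff_of_nonneg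
    (fun x => neg_nonneg.2 (hofbauerPotential_nonpos ha x))
    (integrable_hofbauerPotential ha0 ν).neg] at h1
  have h2 : ∀ᵐ x ∂ν, x = fun _ => 1 := by
    filter_upwards [h1] with x hx
    exact (hofbauerPotential_eq_zero_iff ha).1 (neg_eq_zero.1 hx)
  have h3 : ν.map id = ν.map (fun _ => fun _ => (1 : Fin 2)) := Measure.map_congr h2
  rwa [Measure.map_id, Measure.map_const, measure_univ, one_smul] at h3

theorem isInvariantProb_dirac_ones :
    IsInvariantProb (Measure.dirac (fun _ : ℕ => (1 : Fin 2))) := by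
  refine ⟨inferInstance, measurable_shift, ?_⟩
  exact Measure.map_dirac' measurable_shift _

theorem shiftEntropy_dirac (x : ℕ → Fin 2) : shiftEntropy (Measure.dirac x) = 0 := by
  have h : ∀ n, blockEntropy (Measure.dirac x) n = 0 := by
    intro n
    refine Finset.sum_eq_zero fun w _ => ?_
    by_cases hx : x ∈ cylinderSet w
    · simp [measureReal_def, Measure.dirac_apply' _ (measurableSet_cylinderSet w), hx]
    · simp [measureReal_def, Measure.dirac_apply' _ (measurableSet_cylinderSet w), hx]
  unfold shiftEntropy
  simp only [h, zero_div]
  exact tendsto_const_nhds.limUnder_eq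

/-- The variational inequality for the Hofbauer potential, and a stationary renewal process at which
equality holds. -/
theorem hofbauer_variational (ha : ∀ k, a k < 0) (ha0 : Tendsto a atTop (𝓝 0))
    (h_sum : HasSum (fun k : ℕ => Real.exp (∑ i ∈ Finset.range (k + 1), a i)) 1)
    (h_moment : Summable
      (fun k : ℕ => ((k : ℝ) + 1) * Real.exp (∑ i ∈ Finset.range (k + 1), a i))) :
    (∀ ν : Measure (ℕ → Fin 2), IsInvariantProb ν →
      shiftEntropy ν + ∫ x, hofbauerPotential a x ∂ν ≤ 0) ∧
    ∃ μ : Measure (ℕ → Fin 2), IsInvariantProb μ ∧ μ ≠ Measure.dirac (fun _ => 1) ∧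
      shiftEntropy μ + ∫ x, hofbauerPotential a x ∂μ = 0 := by
  set p : ℕ → ℝ := fun k => Real.exp (∑ i ∈ Finset.range (k + 1), a i) with hpdef
  have hp : ∀ k, 0 < p k := fun k => Real.exp_pos _
  obtain ⟨hq, hqp⟩ := tail_sums_pos_and_recurrence hp h_sum.summable
  have hqs := summable_tail_sums hp h_moment
  set q : ℕ → ℝ := fun k => ∑' i, p (i + k) with hqdef
  obtain ⟨hT, hTq⟩ := tail_sums_pos_and_recurrence hq hqs
  set T : ℕ → ℝ := fun k => ∑' i, q (i + k) with hTdef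
  change ∀ k, 0 < q k at hq
  change ∀ k, q k = p k + q (k + 1) at hqp
  change ∀ k, 0 < T k at hT
  change ∀ k, T k = q k + T (k + 1) at hTq
  have hq0 : q 0 = 1 := h_sum.tsum_eq
  have hqanti : Antitone q := antitone_nat_of_succ_le fun k => by linarith [hqp k, hp k]
  have hTanti : Antitone T := antitone_nat_of_succ_le fun k => by linarith [hTq k, hq k]
  have hq1 : ∀ k, q k ≤ 1 := fun k => hq0 ▸ hqanti (Nat.zero_le k)
  have hpq : ∀ k, p k ≤ q k := fun k => by linarith [hqp k, hq (k + 1)]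
  have hqT : ∀ k, q k ≤ T k := fun k => by linarith [hTq k, hT (k + 1)]
  have hgibbs := abs_log_renewalWeight_sub_birkhoffSum_le ha ha0 hq hT hq0 hq1 hpq hqT
    fun k => hTanti (Nat.zero_le k)
  have hpos := renewalWeight_pos hp hq hT
  obtain ⟨μ, hμ, hcyl⟩ := exists_isInvariantProb_of_consistent (fun l => (hpos l).le) rfl
    (renewalWeight_right hq hT hqp hTq) (renewalWeight_left hq hT hqp hTq)
  have := hμ.1
  set e : ℕ → ℝ := fun n => 2 * ∑ i ∈ Finset.range (n + 1), tailSup a i + Real.log (T 0)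
  -- The Cesàro means of `tailSup a` tend to 0 with the sequence itself.
  have he : Tendsto (fun n : ℕ => e n / n) atTop (𝓝 0) := by
    have h1 := (tendsto_tailSup ha0).cesaro
    have h2 := (tendsto_tailSup ha0).mul tendsto_inv_atTop_nhds_zero_nat
    have h3 := (tendsto_inv_atTop_nhds_zero_nat (𝕜 := ℝ)).mul_const (Real.log (T 0))
    have h4 := ((h1.add h2).const_mul 2).add h3
    simp only [mul_zero, add_zero, zero_mul] at h4
    refine h4.congr fun n => ?_
    simp only [e, Finset.sum_range_succ]
    ring
  have hup : ∀ ν : Measure (ℕ → Fin 2), IsInvariantProb ν →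
      shiftEntropy ν + ∫ x, hofbauerPotential a x ∂ν ≤ 0 := by
    intro ν hν
    have := hν.1
    refine shiftEntropy_add_integral_nonpos hν (integrable_hofbauerPotential ha0 ν)
      (q := fun n w => renewalWeight p q T (List.ofFn w)) (fun n w => hpos _) (fun n => ?_) he
      fun n x => ?_
    · simp only [← hcyl]
      exact sum_measureReal_cylinderSet μ n
    · have := (abs_le.1 (hgibbs n x)).1
      simp only [e]
      linarith
  refine ⟨hup, μ, hμ, fun h => ?_, le_antisymm (hup μ hμ) ?_⟩
  -- The cylinder [0] has positive μ-mass but is null for the unit mass at 11….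
  · have h1 := hcyl 1 (fun _ => 0)
    have h2 := hpos (List.ofFn fun _ : Fin 1 => 0)
    rw [← h1, h, measureReal_def, Measure.dirac_apply' _ (measurableSet_cylinderSet _)] at h2
    simp [cylinderSet] at h2
  · refine shiftEntropy_add_integral_nonneg hμ (integrable_hofbauerPotential ha0 μ) he fun n x => ?_
    rw [hcyl]
    have := (abs_le.1 (hgibbs n x)).2
    simp only [e]
    linarith

end Pressure

/-! ### The corner of the pressure at β = 1 -/

theorem mainTheorem9 (a : ℕ → ℝ) (ha_neg : ∀ k, a k < 0) (ha_lim : Tendsto a atTop (𝓝 0))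
    (h_sum : HasSum (fun k : ℕ => Real.exp (∑ i ∈ Finset.range (k + 1), a i)) 1)
    (h_moment : Summable
      (fun k : ℕ => ((k : ℝ) + 1) * Real.exp (∑ i ∈ Finset.range (k + 1), a i))) :
    -- `φ` is continuous, and the suprema defining the pressures `P(βφ)` are finite
    Continuous (hofbauerPotential a) ∧
    (∀ β : ℝ, IsLUB (freeEnergies (β • hofbauerPotential a))
      (pressure (β • hofbauerPotential a))) ∧
    -- the pressure vanishes for `β ≥ 1`, with right derivative `0` at `β = 1`
    (∀ β : ℝ, 1 ≤ β → pressure (β • hofbauerPotential a) = 0) ∧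
    HasDerivWithinAt (fun β : ℝ => pressure (β • hofbauerPotential a)) 0 (Ici 1) 1 ∧
    -- the unit mass at `11…` is an equilibrium state for `φ`, and there is another one
    IsEquilibriumState (hofbauerPotential a) (Measure.dirac (fun _ => 1)) ∧
    (∃ μ₁ : Measure (ℕ → Fin 2), μ₁ ≠ Measure.dirac (fun _ => 1) ∧
      IsEquilibriumState (hofbauerPotential a) μ₁) ∧
    -- the left derivative at `β = 1` exists, and it is at most `⟨φ, μ₁⟩ < 0`
    (∃ D : ℝ,
      HasDerivWithinAt (fun β : ℝ => pressure (β • hofbauerPotential a)) D (Iic 1) 1 ∧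
      ∀ μ₁ : Measure (ℕ → Fin 2), μ₁ ≠ Measure.dirac (fun _ => 1) →
        IsEquilibriumState (hofbauerPotential a) μ₁ →
          shiftEntropy μ₁ + ∫ x, hofbauerPotential a x ∂μ₁ = 0 ∧
          (∫ x, hofbauerPotential a x ∂μ₁) < 0 ∧
          (∀ β : ℝ, -(1 - β) * (∫ x, hofbauerPotential a x ∂μ₁) ≤
            pressure (β • hofbauerPotential a)) ∧
          D ≤ ∫ x, hofbauerPotential a x ∂μ₁) ∧
    ¬ DifferentiableAt ℝ (fun β : ℝ => pressure (β • hofbauerPotential a)) 1 := by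
  obtain ⟨hvar, μ, hμ, hμne, hμ0⟩ := hofbauer_variational ha_neg ha_lim h_sum h_moment
  set φ := hofbauerPotential a with hφ
  set P : ℝ → ℝ := fun β => pressure (β • φ) with hP
  have hdirac := isInvariantProb_dirac_ones
  have hsmul : ∀ (β : ℝ) (ν : Measure (ℕ → Fin 2)),
      ∫ x, (β • φ) x ∂ν = β * ∫ x, φ x ∂ν := fun β ν => by
    simp only [Pi.smul_apply, smul_eq_mul]
    exact integral_const_mul β φ
  have hdirac0 : ∫ x, φ x ∂(Measure.dirac (fun _ : ℕ => (1 : Fin 2))) = 0 := by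
    rw [integral_dirac' _ _ (continuous_hofbauerPotential ha_lim).stronglyMeasurable]
    exact hofbauerPotential_ones a
  have hlub : ∀ β, IsLUB (freeEnergies (β • φ)) (P β) := by
    intro β
    -- Writing βφ = φ + (β-1)φ, the first summand is controlled by the variational inequality and
    -- the second by sup|φ|.
    refine isLUB_csSup ⟨_, _, hdirac, rfl⟩ ⟨|β - 1| * tailSup a 0, ?_⟩
    rintro _ ⟨ν, hν, rfl⟩
    have := hν.1
    have h1 := hvar ν hν
    have h2 := (le_abs_self _).trans_eq (abs_mul (β - 1) (∫ x, φ x ∂ν))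
    have h3 := mul_le_mul_of_nonneg_left (abs_integral_hofbauerPotential_le ha_lim ν)
      (abs_nonneg (β - 1))
    rw [hsmul]
    linarith
  have hle : ∀ β ν, IsInvariantProb ν → shiftEntropy ν + β * ∫ x, φ x ∂ν ≤ P β := by
    intro β ν hν
    rw [← hsmul]
    exact (hlub β).1 ⟨ν, hν, rfl⟩
  have hPle : ∀ β c, (∀ ν, IsInvariantProb ν → shiftEntropy ν + β * ∫ x, φ x ∂ν ≤ c) →
      P β ≤ c := by
    intro β c h
    refine (hlub β).2 ?_
    rintro _ ⟨ν, hν, rfl⟩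
    rw [hsmul]
    exact h ν hν
  have hzero : ∀ β, 1 ≤ β → P β = 0 := by
    intro β hβ
    refine le_antisymm (hPle β 0 fun ν hν => ?_) ?_
    · have h1 := hvar ν hν
      have h2 := integral_hofbauerPotential_nonpos ha_neg ν
      nlinarith
    · have := hle β _ hdirac
      rwa [shiftEntropy_dirac, hdirac0, mul_zero, add_zero] at this
  have hP1 : P 1 = 0 := hzero 1 le_rfl
  have heq : ∀ ν, IsInvariantProb ν → shiftEntropy ν + ∫ x, φ x ∂ν = 0 →
      IsEquilibriumState φ ν := by
    intro ν hν h0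
    refine ⟨hν, ⟨ν, hν, rfl⟩, ?_⟩
    rintro _ ⟨ν', hν', rfl⟩
    rw [h0]
    exact hvar ν' hν'
  have heq0 : ∀ ν, IsEquilibriumState φ ν → shiftEntropy ν + ∫ x, φ x ∂ν = 0 := by
    intro ν hν
    refine le_antisymm (hvar ν hν.1) (hμ0 ▸ hν.2.2 ⟨μ, hμ, rfl⟩)
  have hbound : ∀ ν, IsEquilibriumState φ ν → ∀ β, -(1 - β) * (∫ x, φ x ∂ν) ≤ P β := by
    intro ν hν β
    have h1 := hle β ν hν.1
    have h2 := heq0 ν hν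
    linarith
  -- P is a supremum of functions affine in β; convexity provides the left derivative.
  have hconv : ConvexOn ℝ univ P := by
    refine ⟨convex_univ, fun x _ y _ s t hs ht hst => hPle _ _ fun ν hν => ?_⟩
    have h1 := mul_le_mul_of_nonneg_left (hle x ν hν) hs
    have h2 := mul_le_mul_of_nonneg_left (hle y ν hν) ht
    have h3 : shiftEntropy ν = s * shiftEntropy ν + t * shiftEntropy ν := by
      rw [← add_mul, hst, one_mul]
    simp only [smul_eq_mul]
    linarith
  have hright : HasDerivWithinAt P 0 (Ici 1) 1 :=
    (hasDerivWithinAt_const 1 (Ici 1) (0 : ℝ)).congr (fun β hβ => hzero β hβ) hP1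
  have hleft : HasDerivWithinAt P (derivWithin P (Iio 1) 1) (Iic 1) 1 :=
    (hconv.hasDerivWithinAt_leftDeriv_of_mem_interior (by simp)).Iic_of_Iio
  have hDle : ∀ ν, IsEquilibriumState φ ν → derivWithin P (Iio 1) 1 ≤ ∫ x, φ x ∂ν := by
    intro ν hν
    -- Dividing P(β) ≥ (β-1)⟨φ,ν⟩ by β - 1 < 0 bounds the left slopes from above.
    have ht := hasDerivWithinAt_iff_tendsto_slope.1 hleft
    rw [Iic_sdiff_right] at ht
    refine le_of_tendsto ht ?_
    filter_upwards [self_mem_nhdsWithin] with β hβ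
    have hβ' : β - 1 < 0 := sub_neg.2 hβ
    rw [slope_def_field, hP1, sub_zero, div_le_iff_of_neg hβ']
    have := hbound ν hν β
    linarith
  have hneg : ∀ ν, ν ≠ Measure.dirac (fun _ => 1) → IsEquilibriumState φ ν →
      ∫ x, φ x ∂ν < 0 := by
    intro ν hne hν
    have := hν.1.1
    exact integral_hofbauerPotential_neg ha_neg ha_lim hne
  refine ⟨continuous_hofbauerPotential ha_lim, hlub, hzero, hright, heq _ hdirac ?_,
    ⟨μ, hμne, heq μ hμ hμ0⟩, ⟨derivWithin P (Iio 1) 1, hleft, fun ν hne hν =>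
      ⟨heq0 ν hν, hneg ν hne hν, hbound ν hν, hDle ν hν⟩⟩, fun hd => ?_⟩
  · rw [shiftEntropy_dirac, hdirac0, add_zero]
  · have h1 := (uniqueDiffWithinAt_Ici (1 : ℝ)).eq_deriv _ hd.hasDerivAt.hasDerivWithinAt hright
    have h2 := (uniqueDiffWithinAt_Iic (1 : ℝ)).eq_deriv _ hd.hasDerivAt.hasDerivWithinAt hleft
    have h3 := hDle μ (heq μ hμ hμ0)
    have h4 := hneg μ hμne (heq μ hμ hμ0)
    linarith
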